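/- Let $K$ be a field, let $X=(X_{ij})$ be an $m\times n$ matrix of distinct indeterminates with $m\le n$, and let $K[X]=K[X_{ij}:1\le i\le m,\ 1\le j\le n]$ with its standard grading. For $1\le k<l\le n$ with $l-k+1\ge m$, let $J_{kl}$ be the ideal of $K[X]$ generated by the diagonal monomials $X_{1c_1}X_{2c_2}\cdots X_{mc_m}$ with $k\le c_1<c_2<\cdots<c_m\le l$, i.e. the products of the main diagonal entries of the $m\times m$ submatrices of the submatrix $Y_{kl}$ of $X$ consisting of the columns $k,k+1,\ldots,l$. Let $1\le k_1\le k_2\le\cdots\le k_s<n$ and $1<l_1\le l_2\le\cdots\le l_s\le n$ be such that $k_i<l_i$ and $l_i-k_i+1\ge m$ for every $i$. Then the ideal $J:=J_{k_1l_1}J_{k_2l_2}\cdots J_{k_sl_s}$ has a linear free resolution: its minimal graded free resolution over $S=K[X]$ has the form $$0\to S(-sm-p)^{b_p}\to\cdots\to S(-sm-1)^{b_1}\to S(-sm)^{b_0}\to J\to 0 .$$ Equivalently, its Castelnuovo–Mumford regularity, that is, the maximum of $j-i$ over all $i,j$ such that $S(-j)$ is a direct summand of the $i$-th module of the minimal graded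 free resolution of $J$, is $\operatorname{reg}(J)=sm$. -/

import Mathlib

open MvPolynomial

/-- A finite graded free resolution
`0 → F_N → ⋯ → F_1 → F_0 → I → 0` of an ideal `I` of the standard graded polynomial ring
`S = K[x_v : v ∈ σ]`. Here `F_i = ⨁_p S(-deg i p)`, that is, the `p`-th basis vector of
`F_i = S ^ (rank i)` has degree `deg i p`, and all maps are homogeneous of degree `0`. -/
structure GradedFreeResolution {σ K : Type*} [Field K] (I : Ideal (MvPolynomial σ K)) where
  /-- the rank of `F_i` -/
  rank : ℕ → ℕ
  /-- the degrees of the basis vectors of `F_i` -/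
  deg : (i : ℕ) → Fin (rank i) → ℕ
  /-- the augmentation `F_0 → I ⊆ S` -/
  aug : (Fin (rank 0) → MvPolynomial σ K) →ₗ[MvPolynomial σ K] MvPolynomial σ K
  /-- the differential `F_{i+1} → F_i` -/
  d : (i : ℕ) → (Fin (rank (i + 1)) → MvPolynomial σ K) →ₗ[MvPolynomial σ K]
    (Fin (rank i) → MvPolynomial σ K)
  /-- the augmentation sends a basis vector to a form of the same degree -/
  aug_homogeneous : ∀ p, (aug (Pi.single p 1)).IsHomogeneous (deg 0 p)
  /-- every monomial `x^e` in the matrix entry at `(p, q)` of the differential has degree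
  `deg (i + 1) q - deg i p`; in particular the entry is `0` if this number is negative -/
  d_homogeneous : ∀ i q p, ∀ e ∈ (d i (Pi.single q 1) p).support,
    e.degree + deg i p = deg (i + 1) q
  /-- the augmentation maps onto `I` -/
  range_aug : LinearMap.range aug = I
  /-- exactness at `F_0` -/
  exact_zero : LinearMap.range (d 0) = LinearMap.ker aug
  /-- exactness at `F_{i+1}` -/
  exact_succ : ∀ i, LinearMap.range (d (i + 1)) = LinearMap.ker (d i)
  /-- the resolution has finite length -/
  finite_length : ∃ N, ∀ i, N ≤ i → rank i = 0

namespace GradedFreeResolution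

variable {σ K : Type*} [Field K] {I : Ideal (MvPolynomial σ K)}

/-- A graded free resolution is minimal if the image of `F_{i+1}` lies in `𝔪 F_i` for all `i`,
where `𝔪` is the ideal generated by the variables: no matrix entry of a differential has a
constant term. -/
def IsMinimal (F : GradedFreeResolution I) : Prop :=
  ∀ i q p, constantCoeff (F.d i (Pi.single q 1) p) = 0

/-- The resolution is `d`-linear if `F_i = S(-d-i) ^ (rank i)` for all `i`. -/
def IsLinear (F : GradedFreeResolution I) (d : ℕ) : Prop :=
  ∀ i p, F.deg i p = d + i

/-- The set of all numbers `j - i` such that `S(-j)` is a direct summand of `F_i`. -/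
def slopes (F : GradedFreeResolution I) : Set ℤ :=
  {r | ∃ (i : ℕ) (p : Fin (F.rank i)), r = (F.deg i p : ℤ) - (i : ℤ)}

end GradedFreeResolution

/-- The ideal `I` is generated in degree `d` and has a linear (minimal graded) free resolution
`⋯ → S(-d-1)^{b_1} → S(-d)^{b_0} → I → 0`. -/
def HasLinearResolution {σ K : Type*} [Field K] (I : Ideal (MvPolynomial σ K)) (d : ℕ) : Prop :=
  ∃ F : GradedFreeResolution I, F.IsMinimal ∧ F.IsLinear d

/-- `reg(I) = r`: the ideal `I` has a minimal graded free resolution, and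
`r = max {j - i : S(-j) is a direct summand of F_i}` for the minimal graded free resolution
(that is, for every one: they are all isomorphic). -/
def HasRegularity {σ K : Type*} [Field K] (I : Ideal (MvPolynomial σ K)) (r : ℤ) : Prop :=
  (∃ F : GradedFreeResolution I, F.IsMinimal) ∧
    ∀ F : GradedFreeResolution I, F.IsMinimal → IsGreatest F.slopes r

/-- The diagonal monomial `X_{1 c_1} ⋯ X_{m c_m}` of the maximal minor `[c_1, …, c_m]` of the
generic `m × n` matrix. -/
noncomputable def diagonalMonomial (K : Type*) [Field K] {m n : ℕ} (c : Fin m → Fin n) :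
    MvPolynomial (Fin m × Fin n) K :=
  ∏ i, Matrix.mvPolynomialX (Fin m) (Fin n) K i (c i)

/-- The ideal `J_{kl}` of `K[X]` generated by the diagonal monomials of all maximal minors of the
submatrix `Y_{kl}` formed by the columns `k, …, l` of the generic `m × n` matrix `X`. -/
noncomputable def diagonalIdeal (K : Type*) [Field K] (m : ℕ) {n : ℕ} (k l : Fin n) :
    Ideal (MvPolynomial (Fin m × Fin n) K) :=
  Ideal.span {f | ∃ c : Fin m → Fin n, StrictMono c ∧ (∀ i, k ≤ c i ∧ c i ≤ l) ∧
    f = diagonalMonomial K c}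

/-!
The product `J` of the ideals `J_{k_i l_i}` is a monomial ideal with linear quotients, and an ideal
with linear quotients generated in degree `d` has a linear resolution.

A product of `s` diagonal monomials is recorded by an array with `m` rows and `s` columns, the `i`-th
column being the sequence of column indices of the `i`-th factor. Sorting every row leaves the monomial
unchanged, keeps the columns strictly increasing and, since `k` and `l` are monotone, respects the
bounds `k_i` and `l_i` (`prod_diagonalIdeal`). So `J` is generated by the monomials of the sorted
arrays. Order these lexicographically, row by row. If `b' < b` are sorted and `(a, i)` is the first
position at which they differ, then replacing the entry of `b` at `(a, i)` by that of `b'` gives a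
sorted array before `b`. It shows that the variable `X_{a, b' (a, i)}`, which occurs in the monomial of
`b'` with a larger exponent than in that of `b`, lies in the colon ideal of the earlier monomials by
that of `b`. Hence all these colon ideals are generated by variables.

On the homological side, `LinearlyResolved` is a recursive predicate on submodules of free modules: the
module is spanned by forms of one degree and the syzygies of these are linearly resolved in degree `1`.
The horseshoe lemma for this predicate handles the extensions in a filtration with linear quotients,
the Koszul resolutions of ideals of variables being a special case. Unfolding the recursion yields a
linear resolution, which is minimal because its matrices have linear entries.

For the regularity, every minimal resolution has to be considered. `LinearlyResolved.of_minimal`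
compares one step of an arbitrary minimal resolution with the linear one and shows that the degrees
agree and that the syzygies are again linearly resolved, so induction gives all the degrees.
-/

open MvPolynomial

namespace LinearResolution

variable {σ K : Type*} [Field K]

/-! ### Homogeneous vectors in free modules -/

lemma homogeneousComponent_mul_isHomogeneous {f : MvPolynomial σ K} {e : ℕ}
    (hf : f.IsHomogeneous e) (j : ℕ) (a : MvPolynomial σ K) :
    homogeneousComponent (e + j) (a * f) = homogeneousComponent j a * f := by
  induction a using MvPolynomial.induction_on' with
  | monomial u r =>
    have h1 : (monomial u r : MvPolynomial σ K).IsHomogeneous u.degree :=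
      isHomogeneous_monomial r rfl
    rw [homogeneousComponent_of_mem (h1.mul hf), homogeneousComponent_of_mem h1]
    by_cases h : j = u.degree
    · rw [if_pos h, if_pos (by omega)]
    · rw [if_neg h, if_neg (by omega), zero_mul]
  | add p q hp hq => rw [add_mul, map_add, hp, hq, map_add, add_mul]

lemma homogeneousComponent_mul_of_lt {f : MvPolynomial σ K} {e : ℕ}
    (hf : f.IsHomogeneous e) {j : ℕ} (hj : j < e) (a : MvPolynomial σ K) :
    homogeneousComponent j (a * f) = 0 := by
  induction a using MvPolynomial.induction_on' with
  | monomial u r =>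
    have h1 : (monomial u r : MvPolynomial σ K).IsHomogeneous u.degree :=
      isHomogeneous_monomial r rfl
    rw [homogeneousComponent_of_mem (h1.mul hf), if_neg (by omega)]
  | add p q hp hq => rw [add_mul, map_add, hp, hq, add_zero]

/-- A vector of polynomials all of whose entries are forms of degree `e`, that is, a homogeneous
element of degree `e` in the free module on basis vectors of degree `0`. -/
def HomVec {ι : Type*} (e : ℕ) (v : ι → MvPolynomial σ K) : Prop :=
  ∀ p, (v p).IsHomogeneous e

/-- The homogeneous component of degree `j` of a vector of polynomials, taken entrywise. -/
noncomputable def vecComp {ι : Type*} (j : ℕ) (v : ι → MvPolynomial σ K) :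
    ι → MvPolynomial σ K :=
  fun p => homogeneousComponent j (v p)

lemma homVec_vecComp {ι : Type*} (j : ℕ) (v : ι → MvPolynomial σ K) : HomVec j (vecComp j v) :=
  fun p => homogeneousComponent_isHomogeneous j (v p)

lemma HomVec.vecComp_eq {ι : Type*} {j : ℕ} {v : ι → MvPolynomial σ K} (hv : HomVec j v) :
    vecComp j v = v :=
  funext fun p => by
    rw [vecComp, homogeneousComponent_of_mem (hv p), if_pos rfl]

lemma vecComp_linearCombination {ι κ : Type*} [Fintype κ] {e : ℕ}
    {g : κ → ι → MvPolynomial σ K} (hg : ∀ q, HomVec e (g q)) (j : ℕ)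
    (c : κ → MvPolynomial σ K) :
    vecComp (e + j) (Fintype.linearCombination (MvPolynomial σ K) g c) =
      Fintype.linearCombination (MvPolynomial σ K) g (vecComp j c) := by
  funext p
  simp only [vecComp, Fintype.linearCombination_apply, Finset.sum_apply, Pi.smul_apply,
    smul_eq_mul, map_sum]
  exact Finset.sum_congr rfl fun q _ => homogeneousComponent_mul_isHomogeneous (hg q p) j (c q)

lemma vecComp_linearCombination_of_lt {ι κ : Type*} [Fintype κ] {e : ℕ}
    {g : κ → ι → MvPolynomial σ K} (hg : ∀ q, HomVec e (g q)) {j : ℕ} (hj : j < e)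
    (c : κ → MvPolynomial σ K) :
    vecComp j (Fintype.linearCombination (MvPolynomial σ K) g c) = 0 := by
  funext p
  simp only [vecComp, Fintype.linearCombination_apply, Finset.sum_apply, Pi.smul_apply,
    smul_eq_mul, map_sum, Pi.zero_apply]
  exact Finset.sum_eq_zero fun q _ => homogeneousComponent_mul_of_lt (hg q p) hj (c q)

lemma HomVec.linearCombination {ι κ : Type*} [Fintype κ] {e j : ℕ}
    {g : κ → ι → MvPolynomial σ K} (hg : ∀ q, HomVec e (g q))
    {c : κ → MvPolynomial σ K} (hc : HomVec j c) :
    HomVec (e + j) (Fintype.linearCombination (MvPolynomial σ K) g c) := by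
  have h := vecComp_linearCombination hg j c
  rw [hc.vecComp_eq] at h
  rw [← h]
  exact homVec_vecComp _ _

/-- A homogeneous element of the span of forms of degree `e` has homogeneous coefficients. -/
lemma exists_homVec_linearCombination {ι κ : Type*} [Fintype κ] {e j : ℕ}
    {g : κ → ι → MvPolynomial σ K} (hg : ∀ q, HomVec e (g q)) {v : ι → MvPolynomial σ K}
    (hv : v ∈ Submodule.span (MvPolynomial σ K) (Set.range g)) (hj : HomVec (e + j) v) :
    ∃ c : κ → MvPolynomial σ K, HomVec j c ∧
      Fintype.linearCombination (MvPolynomial σ K) g c = v := by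
  rw [← Fintype.range_linearCombination] at hv
  obtain ⟨c, rfl⟩ := hv
  exact ⟨vecComp j c, homVec_vecComp _ _, by rw [← vecComp_linearCombination hg, hj.vecComp_eq]⟩

/-- A submodule of a free module (with basis in degree `0`) is graded. -/
def IsGraded {ι : Type*} (Z : Submodule (MvPolynomial σ K) (ι → MvPolynomial σ K)) : Prop :=
  ∀ v ∈ Z, ∀ j, vecComp j v ∈ Z

lemma isGraded_ker {ι κ : Type*} [Fintype κ] {e : ℕ}
    {g : κ → ι → MvPolynomial σ K} (hg : ∀ q, HomVec e (g q)) :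
    IsGraded (LinearMap.ker (Fintype.linearCombination (MvPolynomial σ K) g)) := by
  intro c hc j
  rw [LinearMap.mem_ker] at hc ⊢
  rw [← vecComp_linearCombination hg, hc]
  funext p
  simp [vecComp]

/-! ### Submodules with a linear resolution -/

/-- The submodule `Z` of the free module `S ^ ι` is generated by forms of degree `e` and has a
linear free resolution with at most `N` nonzero terms: `Z` is zero if `N = 0`; otherwise `Z` is
spanned by a finite family of vectors of degree `e`, and the syzygies of this family have a resolution
of the same kind with at most `N - 1` nonzero terms, generated in degree `1` with respect to the new
basis vectors. -/
def LinearlyResolved : ℕ → ℕ → ∀ {ι : Type},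
    Submodule (MvPolynomial σ K) (ι → MvPolynomial σ K) → Prop
  | 0, _, _, Z => Z = ⊥
  | N + 1, e, ι, Z => ∃ (κ : Type) (_ : Fintype κ) (g : κ → ι → MvPolynomial σ K),
      (∀ q, HomVec e (g q)) ∧ Submodule.span (MvPolynomial σ K) (Set.range g) = Z ∧
        LinearlyResolved N 1 (LinearMap.ker (Fintype.linearCombination (MvPolynomial σ K) g))

lemma linearlyResolved_bot (N e : ℕ) (ι : Type) :
    LinearlyResolved N e (⊥ : Submodule (MvPolynomial σ K) (ι → MvPolynomial σ K)) := by
  induction N generalizing e ι with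
  | zero => exact rfl
  | succ N ih =>
    refine ⟨Empty, inferInstance, fun q => q.elim, fun q => q.elim, by simp, ?_⟩
    rw [Submodule.eq_bot_of_subsingleton (p := LinearMap.ker _)]
    exact ih 1 Empty

lemma LinearlyResolved.succ {N e : ℕ} {ι : Type}
    {Z : Submodule (MvPolynomial σ K) (ι → MvPolynomial σ K)} (h : LinearlyResolved N e Z) :
    LinearlyResolved (N + 1) e Z := by
  induction N generalizing e ι with
  | zero =>
    have h' : Z = ⊥ := h
    rw [h']
    exact linearlyResolved_bot 1 e ι
  | succ N ih =>
    obtain ⟨κ, hκ, g, hg, hs, hl⟩ := h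
    exact ⟨κ, hκ, g, hg, hs, ih hl⟩

lemma LinearlyResolved.mono {N M e : ℕ} {ι : Type}
    {Z : Submodule (MvPolynomial σ K) (ι → MvPolynomial σ K)} (h : LinearlyResolved N e Z)
    (hNM : N ≤ M) : LinearlyResolved M e Z := by
  induction hNM with
  | refl => exact h
  | step _ ih => exact ih.succ

/-- An injective linear map that preserves the degree of the generators transports linear
resolutions, because it does not change the syzygies. -/
lemma LinearlyResolved.map {N e : ℕ} {ι ι' : Type}
    {Z : Submodule (MvPolynomial σ K) (ι → MvPolynomial σ K)} (h : LinearlyResolved N e Z)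
    (G : (ι → MvPolynomial σ K) →ₗ[MvPolynomial σ K] (ι' → MvPolynomial σ K))
    (hG : Function.Injective G) (hdeg : ∀ v, HomVec e v → HomVec e (G v)) :
    LinearlyResolved N e (Z.map G) := by
  cases N with
  | zero =>
    have h' : Z = ⊥ := h
    rw [h', Submodule.map_bot]
    exact linearlyResolved_bot 0 e ι'
  | succ N =>
    obtain ⟨κ, hκ, g, hg, hs, hl⟩ := h
    refine ⟨κ, hκ, fun q => G (g q), fun q => hdeg _ (hg q), ?_, ?_⟩
    · rw [← hs, Submodule.map_span, ← Set.range_comp]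
      rfl
    · convert hl using 1
      ext c
      have : Fintype.linearCombination (MvPolynomial σ K) (fun q => G (g q)) c =
          G (Fintype.linearCombination (MvPolynomial σ K) g c) := by
        simp [Fintype.linearCombination_apply]
      rw [LinearMap.mem_ker, LinearMap.mem_ker, this, map_eq_zero_iff G hG]

/-- The horseshoe lemma: if `Z ⊆ S ^ (ι ⊕ κ)` is graded, and both the part of `Z` inside `S ^ ι` and
the projection of `Z` to `S ^ κ` are linearly resolved, then so is `Z`. The generators are those of
`Z ∩ S ^ ι` together with lifts of those of the projection, and the syzygies of the resulting family
satisfy the hypotheses again. -/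
lemma LinearlyResolved.horseshoe {N e : ℕ} {ι κ : Type}
    {Z : Submodule (MvPolynomial σ K) (ι ⊕ κ → MvPolynomial σ K)} (hZ : IsGraded Z)
    {Z₁ : Submodule (MvPolynomial σ K) (ι → MvPolynomial σ K)}
    {Z₂ : Submodule (MvPolynomial σ K) (κ → MvPolynomial σ K)}
    (hZ₁ : ∀ u, u ∈ Z₁ ↔ Sum.elim u 0 ∈ Z)
    (hZ₂ : ∀ w, w ∈ Z₂ ↔ ∃ u, Sum.elim u w ∈ Z)
    (h₁ : LinearlyResolved N e Z₁) (h₂ : LinearlyResolved N e Z₂) : LinearlyResolved N e Z := by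
  induction N generalizing e ι κ with
  | zero =>
    have h₁' : Z₁ = ⊥ := h₁
    have h₂' : Z₂ = ⊥ := h₂
    refine (Submodule.eq_bot_iff Z).2 fun v hv => ?_
    have hv' : Sum.elim (fun p => v (Sum.inl p)) (fun p => v (Sum.inr p)) = v :=
      Sum.elim_comp_inl_inr v
    have hr : (fun p => v (Sum.inr p)) = 0 := by
      rw [← Submodule.mem_bot (MvPolynomial σ K), ← h₂', hZ₂]
      exact ⟨_, hv'.symm ▸ hv⟩
    have hl : (fun p => v (Sum.inl p)) = 0 := by
      rw [← Submodule.mem_bot (MvPolynomial σ K), ← h₁', hZ₁, ← hr, hv']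
      exact hv
    rw [← hv', hr, hl]
    exact Sum.elim_zero_zero
  | succ N ih =>
    obtain ⟨κ₁, _, g₁, hg₁, hs₁, hl₁⟩ := h₁
    obtain ⟨κ₂, _, g₂, hg₂, hs₂, hl₂⟩ := h₂
    -- `Z` is graded, so every lift of `g₂ q` can be replaced by its component of degree `e`.
    have hlift : ∀ q, ∃ u : ι → MvPolynomial σ K, HomVec e u ∧ Sum.elim u (g₂ q) ∈ Z := by
      intro q
      obtain ⟨u, hu⟩ := (hZ₂ (g₂ q)).1 (hs₂ ▸ Submodule.subset_span ⟨q, rfl⟩)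
      refine ⟨vecComp e u, homVec_vecComp _ _, ?_⟩
      convert hZ _ hu e using 1
      funext p
      rcases p with p | p
      · rfl
      · exact (congrFun (hg₂ q).vecComp_eq p).symm
    choose u hu huZ using hlift
    let G : κ₁ ⊕ κ₂ → ι ⊕ κ → MvPolynomial σ K :=
      Sum.elim (fun q => Sum.elim (g₁ q) 0) (fun q => Sum.elim (u q) (g₂ q))
    have hG : ∀ q, HomVec e (G q) := by
      rintro (q | q) (p | p)
      · exact hg₁ q p
      · exact isHomogeneous_zero _ _ _
      · exact hu q p
      · exact hg₂ q p
    have hGe : ∀ (a : κ₁ → MvPolynomial σ K) (b : κ₂ → MvPolynomial σ K),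
        Fintype.linearCombination (MvPolynomial σ K) G (Sum.elim a b) =
          Sum.elim (Fintype.linearCombination (MvPolynomial σ K) g₁ a +
            Fintype.linearCombination (MvPolynomial σ K) u b)
            (Fintype.linearCombination (MvPolynomial σ K) g₂ b) := by
      intro a b
      funext p
      rcases p with p | p <;>
        simp [G, Fintype.linearCombination_apply, Finset.sum_apply, Fintype.sum_sum_type]
    have hGZ : ∀ q, G q ∈ Z := by
      rintro (q | q)
      · exact (hZ₁ _).1 (hs₁ ▸ Submodule.subset_span ⟨q, rfl⟩)
      · exact huZ q
    have hGZ' : ∀ c, Fintype.linearCombination (MvPolynomial σ K) G c ∈ Z := fun c => by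
      rw [Fintype.linearCombination_apply]
      exact Submodule.sum_mem _ fun q _ => Submodule.smul_mem _ _ (hGZ q)
    have hlift₁ : ∀ x : ι → MvPolynomial σ K, Sum.elim x 0 ∈ Z →
        ∃ a, Fintype.linearCombination (MvPolynomial σ K) g₁ a = x := by
      intro x hx
      have := (hZ₁ x).2 hx
      rwa [← hs₁, ← Fintype.range_linearCombination] at this
    refine ⟨κ₁ ⊕ κ₂, inferInstance, G, hG, ?_, ?_⟩
    · refine le_antisymm (Submodule.span_le.2 ?_) ?_
      · rintro _ ⟨q, rfl⟩
        exact hGZ q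
      · intro v hv
        rw [← Fintype.range_linearCombination]
        have hv' : Sum.elim (fun p => v (Sum.inl p)) (fun p => v (Sum.inr p)) = v :=
          Sum.elim_comp_inl_inr v
        have h2 : (fun p => v (Sum.inr p)) ∈ Z₂ := (hZ₂ _).2 ⟨_, hv'.symm ▸ hv⟩
        rw [← hs₂, ← Fintype.range_linearCombination] at h2
        obtain ⟨b, hb⟩ := h2
        have h1 := Submodule.sub_mem _ hv (hGZ' (Sum.elim 0 b))
        obtain ⟨a, ha⟩ := hlift₁ ((fun p => v (Sum.inl p)) -
          Fintype.linearCombination (MvPolynomial σ K) u b) (by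
            convert h1 using 1
            rw [hGe, ← hv', hb]
            funext p
            rcases p with p | p <;> simp)
        refine ⟨Sum.elim a b, ?_⟩
        rw [hGe, ha, hb, sub_add_cancel, hv']
    · refine ih (isGraded_ker hG) (fun a => ?_) (fun b => ?_) hl₁ hl₂
      · rw [LinearMap.mem_ker, LinearMap.mem_ker, hGe, map_zero, map_zero, add_zero]
        constructor
        · intro h
          rw [h, Sum.elim_zero_zero]
        · intro h
          funext p
          exact congrFun h (Sum.inl p)
      · simp only [LinearMap.mem_ker, hGe]
        constructor
        · intro h
          have h1 := hGZ' (Sum.elim 0 b)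
          rw [hGe, h, map_zero, zero_add] at h1
          obtain ⟨a, ha⟩ := hlift₁ _ h1
          refine ⟨-a, ?_⟩
          rw [map_neg, ha, h, neg_add_cancel, Sum.elim_zero_zero]
        · rintro ⟨a, ha⟩
          funext p
          exact congrFun ha (Sum.inr p)

/-! ### Ideals with linear quotients -/

/-- An ideal of `S`, viewed as a submodule of the free module `S ^ 1`. -/
noncomputable def idealModule (I : Ideal (MvPolynomial σ K)) :
    Submodule (MvPolynomial σ K) (Unit → MvPolynomial σ K) :=
  Submodule.comap (LinearMap.proj ()) I

lemma mem_idealModule {I : Ideal (MvPolynomial σ K)} {v : Unit → MvPolynomial σ K} :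
    v ∈ idealModule I ↔ v () ∈ I := Iff.rfl

lemma idealModule_bot : idealModule (⊥ : Ideal (MvPolynomial σ K)) = ⊥ := by
  refine (Submodule.eq_bot_iff _).2 fun v hv => ?_
  funext p
  exact hv

/-- One step of a filtration with linear quotients: if `I` and the colon ideal `C = (I : f)` are
linearly resolved in degrees `e` and `1`, then `I + (f)` is linearly resolved in degree `e`. -/
lemma LinearlyResolved.sup_span_singleton {N e : ℕ} {I C : Ideal (MvPolynomial σ K)}
    {f : MvPolynomial σ K} (hf : f.IsHomogeneous e) (hC : ∀ c, c ∈ C ↔ c * f ∈ I)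
    (hI : LinearlyResolved (N + 1) e (idealModule I)) (hCl : LinearlyResolved N 1 (idealModule C)) :
    LinearlyResolved (N + 1) e (idealModule (I ⊔ Ideal.span {f})) := by
  obtain ⟨κ, _, g, hg, hs, hl⟩ := hI
  let G : κ ⊕ Unit → Unit → MvPolynomial σ K := Sum.elim g (fun _ _ => f)
  have hG : ∀ q, HomVec e (G q) := by
    rintro (q | q) p
    · exact hg q p
    · exact hf
  have hGe : ∀ (a : κ → MvPolynomial σ K) (b : Unit → MvPolynomial σ K),
      Fintype.linearCombination (MvPolynomial σ K) G (Sum.elim a b) =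
        Fintype.linearCombination (MvPolynomial σ K) g a + fun _ => b () * f := by
    intro a b
    funext p
    simp [G, Fintype.linearCombination_apply, Finset.sum_apply, Fintype.sum_sum_type]
  refine ⟨κ ⊕ Unit, inferInstance, G, hG, ?_, ?_⟩
  · refine le_antisymm (Submodule.span_le.2 ?_) ?_
    · rintro _ ⟨q | q, rfl⟩
      · have : g q ∈ idealModule I := hs ▸ Submodule.subset_span ⟨q, rfl⟩
        exact Ideal.mem_sup_left this
      · exact Ideal.mem_sup_right (Ideal.subset_span rfl)
    · intro v hv
      obtain ⟨x, hx, y, hy, hxy⟩ := Submodule.mem_sup.1 (mem_idealModule.1 hv)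
      obtain ⟨b, rfl⟩ := Ideal.mem_span_singleton'.1 hy
      have hx' : (fun _ => x) ∈ idealModule I := hx
      rw [← hs, ← Fintype.range_linearCombination] at hx'
      obtain ⟨a, ha⟩ := hx'
      rw [← Fintype.range_linearCombination]
      refine ⟨Sum.elim a (fun _ => b), ?_⟩
      rw [hGe, ha]
      funext p
      exact hxy
  · refine LinearlyResolved.horseshoe (isGraded_ker hG) (fun a => ?_) (fun b => ?_) hl hCl
    · rw [LinearMap.mem_ker, LinearMap.mem_ker, hGe]
      simp only [Pi.zero_apply, zero_mul]
      rw [show (fun _ : Unit => (0 : MvPolynomial σ K)) = 0 from rfl, add_zero]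
    · simp only [LinearMap.mem_ker, hGe]
      rw [mem_idealModule, hC, ← neg_mem_iff]
      have : -(b () * f) ∈ I ↔ (fun _ => -(b () * f)) ∈ idealModule I := Iff.rfl
      rw [this, ← hs, ← Fintype.range_linearCombination]
      constructor
      · rintro ⟨a, ha⟩
        refine ⟨a, ?_⟩
        rw [ha]
        funext p
        simp
      · rintro ⟨a, ha⟩
        refine ⟨a, ?_⟩
        rw [eq_neg_of_add_eq_zero_left ha]
        rfl

lemma mul_X_mem_span_X {T : Set σ} {t : σ} (ht : t ∉ T) (c : MvPolynomial σ K) :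
    c ∈ Ideal.span (X '' T : Set (MvPolynomial σ K)) ↔
      c * X t ∈ Ideal.span (X '' T : Set (MvPolynomial σ K)) := by
  refine ⟨fun h => Ideal.mul_mem_right _ _ h, fun h => ?_⟩
  rw [mem_ideal_span_X_image] at h ⊢
  intro e he
  obtain ⟨i, hi, hne⟩ := h (e + Finsupp.single t 1) (by
    rw [support_mul_X]
    exact Finset.mem_map_of_mem _ he)
  refine ⟨i, hi, ?_⟩
  have hit : t ≠ i := fun h => ht (h ▸ hi)
  simpa [Finsupp.single_apply, hit] using hne

/-- Ideals generated by variables have a linear resolution (the Koszul complex). -/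
lemma exists_linearlyResolved_span_X (T : Finset σ) :
    ∃ N, LinearlyResolved N 1
      (idealModule (Ideal.span (X '' (T : Set σ) : Set (MvPolynomial σ K)))) := by
  classical
  induction T using Finset.induction_on with
  | empty =>
    refine ⟨0, ?_⟩
    simp only [Finset.coe_empty, Set.image_empty, Ideal.span_empty, idealModule_bot]
    exact linearlyResolved_bot _ _ _
  | insert t T ht ih =>
    obtain ⟨N, hN⟩ := ih
    refine ⟨N + 1, ?_⟩
    rw [Finset.coe_insert, Set.image_insert_eq, Set.insert_eq, Ideal.span_union, sup_comm]
    exact LinearlyResolved.sup_span_singleton (isHomogeneous_X K t) (mul_X_mem_span_X (by simpa))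
      hN.succ hN

/-- A monomial ideal whose generators `x ^ u b`, all of degree `e`, can be ordered with linear
quotients has a linear resolution. The hypothesis `hlin` says that for `b' < b` some variable `x_v`
divides `x ^ u b' / gcd (x ^ u b', x ^ u b)` and multiplies `x ^ u b` into the ideal of the generators
before `b`. -/
theorem exists_linearlyResolved_of_linearQuotients [Finite σ] {α : Type*} [LinearOrder α]
    (u : α → σ →₀ ℕ) (e : ℕ) (B : Finset α) (hdeg : ∀ b ∈ B, (u b).degree = e)
    (hlin : ∀ b ∈ B, ∀ b' ∈ B, b' < b →
      ∃ v, u b v < u b' v ∧ ∃ b'' ∈ B, b'' < b ∧ u b'' ≤ u b + Finsupp.single v 1) :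
    ∃ N, LinearlyResolved N e (idealModule (Ideal.span
      ((fun b => (monomial (u b) 1 : MvPolynomial σ K)) '' (B : Set α)))) := by
  classical
  cases nonempty_fintype σ
  induction B using Finset.induction_on_max with
  | empty =>
    refine ⟨0, ?_⟩
    simp only [Finset.coe_empty, Set.image_empty, Ideal.span_empty, idealModule_bot]
    exact linearlyResolved_bot _ _ _
  | insert a B hmax ih =>
    obtain ⟨N₁, hN₁⟩ := ih (fun b hb => hdeg b (Finset.mem_insert_of_mem hb)) (by
      intro b hb b' hb' hlt
      obtain ⟨v, hv, b'', hb'', hlt', hle⟩ := hlin b (Finset.mem_insert_of_mem hb) b'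
        (Finset.mem_insert_of_mem hb') hlt
      refine ⟨v, hv, b'', (Finset.mem_insert.1 hb'').resolve_left ?_, hlt', hle⟩
      rintro rfl
      exact lt_asymm hlt' (hmax b hb))
    set I : Ideal (MvPolynomial σ K) :=
      Ideal.span ((fun b => (monomial (u b) 1 : MvPolynomial σ K)) '' (B : Set α)) with hI
    have hmem : ∀ x, x ∈ I ↔ ∀ d ∈ x.support, ∃ b ∈ B, u b ≤ d := by
      intro x
      have h : (fun b => (monomial (u b) 1 : MvPolynomial σ K)) '' (B : Set α) =
          (fun d => monomial d 1) '' (u '' (B : Set α)) := by rw [Set.image_image]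
      rw [hI, h, mem_ideal_span_monomial_image]
      simp
    let T : Finset σ := Finset.univ.filter fun v => ∃ b ∈ B, u b ≤ u a + Finsupp.single v 1
    obtain ⟨N₂, hN₂⟩ := exists_linearlyResolved_span_X (K := K) T
    have hsupp : ∀ (c : MvPolynomial σ K) (d : σ →₀ ℕ),
        d ∈ (c * monomial (u a) 1).support ↔ ∃ d' ∈ c.support, d' + u a = d := by
      intro c d
      rw [mem_support_iff, coeff_mul_monomial', mul_one]
      constructor
      · intro h
        by_cases hle : u a ≤ d
        · rw [if_pos hle] at h
          exact ⟨d - u a, mem_support_iff.2 h, tsub_add_cancel_of_le hle⟩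
        · exact absurd (if_neg hle) h
      · rintro ⟨d', hd', rfl⟩
        rw [if_pos le_add_self, add_tsub_cancel_right]
        exact mem_support_iff.1 hd'
    -- The colon ideal of the earlier generators by `x ^ u a` is generated by the variables in `T`.
    have hC : ∀ c, c ∈ Ideal.span (X '' (T : Set σ) : Set (MvPolynomial σ K)) ↔
        c * monomial (u a) 1 ∈ I := by
      intro c
      rw [mem_ideal_span_X_image, hmem]
      constructor
      · intro h d hd
        obtain ⟨d', hd', rfl⟩ := (hsupp c d).1 hd
        obtain ⟨v, hv, hne⟩ := h d' hd'
        obtain ⟨b, hb, hle⟩ := (Finset.mem_filter.1 (Finset.mem_coe.1 hv)).2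
        refine ⟨b, hb, hle.trans ?_⟩
        rw [add_comm d' (u a)]
        have h1 : Finsupp.single v 1 ≤ d' := Finsupp.single_le_iff.2 (Nat.one_le_iff_ne_zero.2 hne)
        exact add_le_add le_rfl h1
      · intro h d hd
        obtain ⟨b, hb, hle⟩ := h _ ((hsupp c _).2 ⟨d, hd, rfl⟩)
        obtain ⟨v, hv, b'', hb'', hlt, hle'⟩ := hlin a (Finset.mem_insert_self _ _) b
          (Finset.mem_insert_of_mem hb) (hmax b hb)
        refine ⟨v, ?_, ?_⟩
        · exact Finset.mem_coe.2 (Finset.mem_filter.2 ⟨Finset.mem_univ _, b'',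
            (Finset.mem_insert.1 hb'').resolve_left hlt.ne, hle'⟩)
        · have := hle v
          rw [Finsupp.add_apply] at this
          omega
    refine ⟨max N₁ N₂ + 1, ?_⟩
    rw [Finset.coe_insert, Set.image_insert_eq, Set.insert_eq, Ideal.span_union,
      sup_comm (Ideal.span {_})]
    exact LinearlyResolved.sup_span_singleton
      (isHomogeneous_monomial 1 (hdeg a (Finset.mem_insert_self _ _))) hC
      (hN₁.mono ((le_max_left _ _).trans (Nat.le_succ _))) (hN₂.mono (le_max_right _ _))

/-! ### The resolution of a linearly resolved ideal -/

/-- A linearly resolved module is generated in degree `e` by a family indexed by some `Fin r`, with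
a linearly resolved syzygy module. -/
lemma LinearlyResolved.exists_fin {N e : ℕ} {ι : Type}
    {Z : Submodule (MvPolynomial σ K) (ι → MvPolynomial σ K)} (h : LinearlyResolved N e Z) :
    ∃ (r : ℕ) (g : Fin r → ι → MvPolynomial σ K), (∀ q, HomVec e (g q)) ∧
      Submodule.span (MvPolynomial σ K) (Set.range g) = Z ∧
      LinearlyResolved (N - 1) 1
        (LinearMap.ker (Fintype.linearCombination (MvPolynomial σ K) g)) ∧
      (N = 0 → r = 0) := by
  cases N with
  | zero =>
    have h' : Z = ⊥ := h
    refine ⟨0, Fin.elim0, fun q => q.elim0, by simp [h'], ?_, fun _ => rfl⟩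
    rw [Submodule.eq_bot_of_subsingleton (p := LinearMap.ker _)]
    exact linearlyResolved_bot _ _ _
  | succ N =>
    obtain ⟨κ, _, g, hg, hs, hl⟩ := h
    let ε := Fintype.equivFin κ
    refine ⟨Fintype.card κ, fun q => g (ε.symm q), fun q => hg _, ?_, ?_, fun h => by omega⟩
    · rw [← hs, ← ε.symm.surjective.range_comp g]
      rfl
    · have hinj : Function.Injective
          (LinearMap.funLeft (MvPolynomial σ K) (MvPolynomial σ K) ε.symm) :=
        LinearMap.funLeft_injective_of_surjective _ _ _ ε.symm.surjective
      change LinearlyResolved N 1 _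
      convert hl.map (LinearMap.funLeft _ _ ε.symm) hinj fun v hv p => hv _ using 1
      ext c
      have hc : ∀ c : κ → MvPolynomial σ K,
          Fintype.linearCombination (MvPolynomial σ K) (fun q => g (ε.symm q))
            (LinearMap.funLeft (MvPolynomial σ K) _ ε.symm c) =
          Fintype.linearCombination (MvPolynomial σ K) g c := by
        intro c
        simp only [Fintype.linearCombination_apply, LinearMap.funLeft_apply]
        exact Equiv.sum_comp ε.symm fun q => c q • g q
      have hsurj : LinearMap.funLeft (MvPolynomial σ K) (MvPolynomial σ K) ε.symm
          (fun q => c (ε q)) = c := by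
        funext q
        simp [LinearMap.funLeft_apply]
      rw [LinearMap.mem_ker, Submodule.mem_map]
      constructor
      · intro h
        refine ⟨fun q => c (ε q), ?_, hsurj⟩
        rw [LinearMap.mem_ker, ← hc, hsurj, h]
      · rintro ⟨c, h, rfl⟩
        rw [hc]
        exact h

/-- A stage in the construction of a linear resolution: the rank of the last free module built so
far and the syzygies in it that are still to be resolved. -/
structure Stage (σ K : Type*) [Field K] where
  /-- the rank of the last free module -/
  rank : ℕ
  /-- the module of syzygies -/
  syz : Submodule (MvPolynomial σ K) (Fin rank → MvPolynomial σ K)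
  /-- a bound for the number of nonzero terms still to come -/
  len : ℕ
  /-- the syzygies are linearly resolved -/
  lin : LinearlyResolved len 1 syz

/-- The rank of the next free module. -/
noncomputable def Stage.nextRank (s : Stage σ K) : ℕ := s.lin.exists_fin.choose

/-- The images of the basis vectors of the next free module. -/
noncomputable def Stage.gen (s : Stage σ K) :
    Fin s.nextRank → Fin s.rank → MvPolynomial σ K :=
  s.lin.exists_fin.choose_spec.choose

lemma Stage.gen_spec (s : Stage σ K) : (∀ q, HomVec 1 (s.gen q)) ∧
    Submodule.span (MvPolynomial σ K) (Set.range s.gen) = s.syz ∧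
    LinearlyResolved (s.len - 1) 1
      (LinearMap.ker (Fintype.linearCombination (MvPolynomial σ K) s.gen)) ∧
    (s.len = 0 → s.nextRank = 0) :=
  s.lin.exists_fin.choose_spec.choose_spec

lemma Stage.isHomogeneous_gen (s : Stage σ K) (q : Fin s.nextRank) (p : Fin s.rank) :
    (Fintype.linearCombination (MvPolynomial σ K) s.gen (Pi.single q 1) p).IsHomogeneous 1 := by
  rw [Fintype.linearCombination_apply_single, one_smul]
  exact s.gen_spec.1 q p

lemma Stage.range_gen (s : Stage σ K) :
    LinearMap.range (Fintype.linearCombination (MvPolynomial σ K) s.gen) = s.syz := by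
  rw [Fintype.range_linearCombination, s.gen_spec.2.1]

/-- The stage after resolving one more step. -/
noncomputable def Stage.next (s : Stage σ K) : Stage σ K where
  rank := s.nextRank
  syz := LinearMap.ker (Fintype.linearCombination (MvPolynomial σ K) s.gen)
  len := s.len - 1
  lin := s.gen_spec.2.2.1

/-- The stage reached after `i` steps. -/
noncomputable def Stage.iter (s : Stage σ K) : ℕ → Stage σ K
  | 0 => s
  | i + 1 => (s.iter i).next

lemma Stage.len_iter (s : Stage σ K) (i : ℕ) : (s.iter i).len = s.len - i := by
  induction i with
  | zero => rfl
  | succ i ih =>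
    change (s.iter i).len - 1 = _
    omega

theorem LinearlyResolved.hasLinearResolution {N d : ℕ} {I : Ideal (MvPolynomial σ K)}
    (h : LinearlyResolved N d (idealModule I)) : HasLinearResolution I d := by
  obtain ⟨r, g, hg, hs, hl, -⟩ := h.exists_fin
  let s : Stage σ K := ⟨r, _, _, hl⟩
  let D : ∀ i, (Fin (s.iter (i + 1)).rank → MvPolynomial σ K) →ₗ[MvPolynomial σ K]
      (Fin (s.iter i).rank → MvPolynomial σ K) :=
    fun i => Fintype.linearCombination (MvPolynomial σ K) (s.iter i).gen
  have hD : ∀ i q p, (D i (Pi.single q 1) p).IsHomogeneous 1 :=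
    fun i => (s.iter i).isHomogeneous_gen
  have hrange : ∀ i, LinearMap.range (D i) = (s.iter i).syz := fun i => (s.iter i).range_gen
  have haug : ∀ c, Fintype.linearCombination (MvPolynomial σ K) g c = fun _ =>
      Fintype.linearCombination (MvPolynomial σ K) (fun q => g q ()) c := by
    intro c
    funext p
    simp [Fintype.linearCombination_apply, Finset.sum_apply]
  have hrange_aug : LinearMap.range
      (Fintype.linearCombination (MvPolynomial σ K) fun q => g q ()) = I := by
    ext x
    have hx : x ∈ I ↔ (fun _ => x) ∈ idealModule I := Iff.rfl
    rw [hx, ← hs, ← Fintype.range_linearCombination]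
    constructor
    · rintro ⟨c, rfl⟩
      exact ⟨c, haug c⟩
    · rintro ⟨c, hc⟩
      rw [haug] at hc
      exact ⟨c, congrFun hc ()⟩
  have hker_aug : LinearMap.ker (Fintype.linearCombination (MvPolynomial σ K) g) =
      LinearMap.ker (Fintype.linearCombination (MvPolynomial σ K) fun q => g q ()) := by
    ext c
    rw [LinearMap.mem_ker, LinearMap.mem_ker, haug]
    exact ⟨fun h => congrFun h (), fun h => funext fun _ => h⟩
  refine ⟨⟨fun i => (s.iter i).rank, fun i _ => d + i,
    Fintype.linearCombination (MvPolynomial σ K) (fun q : Fin r => g q ()), D, fun p => ?_, ?_,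
    hrange_aug, (hrange 0).trans hker_aug, fun i => hrange (i + 1), ?_⟩,
    ?_, ?_⟩
  · have h1 : ∀ p : Fin r, Fintype.linearCombination (MvPolynomial σ K) (fun q => g q ())
        (Pi.single p 1) = g p () := fun p => by
      rw [Fintype.linearCombination_apply_single, one_smul]
    exact (h1 p).symm ▸ hg p ()
  · intro i q p e he
    have h1 : e.degree = 1 := by
      by_contra h
      exact mem_support_iff.1 he ((hD i q p).coeff_eq_zero h)
    omega
  · refine ⟨s.len + 1, fun i hi => ?_⟩
    obtain ⟨j, rfl⟩ : ∃ j, i = j + 1 := ⟨i - 1, by omega⟩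
    exact (s.iter j).gen_spec.2.2.2 (by rw [s.len_iter]; omega)
  · intro i q p
    rw [constantCoeff_eq]
    exact (hD i q p).coeff_eq_zero (by simp)
  · exact fun i p => rfl

/-! ### Degrees in an arbitrary minimal resolution -/

lemma HomVec.constantCoeff_eq_zero {ι : Type*} {j : ℕ} {v : ι → MvPolynomial σ K}
    (hv : HomVec j v) (hj : j ≠ 0) (p : ι) : constantCoeff (v p) = 0 := by
  rw [constantCoeff_eq]
  exact (hv p).coeff_eq_zero (by simpa using hj.symm)

lemma HomVec.eq_zero_of_constantCoeff {ι : Type*} {v : ι → MvPolynomial σ K}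
    (hv : HomVec 0 v) (h : ∀ p, constantCoeff (v p) = 0) : v = 0 := by
  funext p
  rw [← congrFun hv.vecComp_eq p, vecComp, homogeneousComponent_zero, ← constantCoeff_eq, h,
    C_0, Pi.zero_apply]

lemma LinearlyResolved.vecComp_eq_zero {N e : ℕ} {ι : Type}
    {Z : Submodule (MvPolynomial σ K) (ι → MvPolynomial σ K)} (h : LinearlyResolved N e Z)
    {v : ι → MvPolynomial σ K} (hv : v ∈ Z) {j : ℕ} (hj : j < e) : vecComp j v = 0 := by
  obtain ⟨κ, _, g, hg, hs, -⟩ := h.succ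
  rw [← hs, ← Fintype.range_linearCombination] at hv
  obtain ⟨c, rfl⟩ := hv
  exact vecComp_linearCombination_of_lt hg hj c

lemma LinearlyResolved.constantCoeff_eq_zero {N : ℕ} {ι : Type}
    {Z : Submodule (MvPolynomial σ K) (ι → MvPolynomial σ K)} (h : LinearlyResolved N 1 Z)
    {v : ι → MvPolynomial σ K} (hv : v ∈ Z) (p : ι) : constantCoeff (v p) = 0 := by
  have := congrFun (h.vecComp_eq_zero hv zero_lt_one) p
  rw [vecComp, homogeneousComponent_zero, Pi.zero_apply, ← C_0, C_inj] at this
  rw [constantCoeff_eq, this]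

/-- Uniqueness of one step of a minimal resolution: a minimal homogeneous generating family `ψ` of a
linearly resolved module in degree `e` has all its degrees equal to `e`, and its syzygies are
linearly resolved. Comparing `ψ` with a generating family `g` of the linear resolution, the two
transition matrices are inverse to each other modulo the maximal ideal; this forces the degrees to
agree, so the matrices are constant, hence inverse to each other, and they identify the syzygies of
`ψ` with those of `g`. -/
lemma LinearlyResolved.of_minimal {N e : ℕ} {ι : Type}
    {Z : Submodule (MvPolynomial σ K) (ι → MvPolynomial σ K)} (hZ : LinearlyResolved N e Z)
    {r : ℕ} {ψ : Fin r → ι → MvPolynomial σ K} {deg : Fin r → ℕ}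
    (hψ : ∀ p, HomVec (deg p) (ψ p))
    (hspan : Submodule.span (MvPolynomial σ K) (Set.range ψ) = Z)
    (hmin : ∀ c ∈ LinearMap.ker (Fintype.linearCombination (MvPolynomial σ K) ψ),
      ∀ p, constantCoeff (c p) = 0) :
    (∀ p, deg p = e) ∧ LinearlyResolved N 1
      (LinearMap.ker (Fintype.linearCombination (MvPolynomial σ K) ψ)) := by
  obtain ⟨κ, _, g, hg, hs, hl⟩ := hZ.succ
  have hψ0 : ∀ p, ψ p ≠ 0 := by
    intro p hp
    have := hmin (Pi.single p 1) (by
      rw [LinearMap.mem_ker, Fintype.linearCombination_apply_single, hp, smul_zero]) p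
    simp at this
  have hψZ : ∀ p, ψ p ∈ Z := fun p => hspan ▸ Submodule.subset_span ⟨p, rfl⟩
  have hH : ∀ p, ∃ (j : ℕ) (c : κ → MvPolynomial σ K), deg p = e + j ∧ HomVec j c ∧
      Fintype.linearCombination (MvPolynomial σ K) g c = ψ p := by
    intro p
    rcases lt_or_ge (deg p) e with h | h
    · exact absurd ((hψ p).vecComp_eq ▸ hZ.vecComp_eq_zero (hψZ p) h) (hψ0 p)
    · obtain ⟨j, hj⟩ := Nat.exists_eq_add_of_le h
      obtain ⟨c, hc, hc'⟩ := exists_homVec_linearCombination (j := j) hg (v := ψ p)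
        (hs ▸ hψZ p) (hj ▸ hψ p)
      exact ⟨j, c, hj, hc, hc'⟩
  choose j H hj hHj hHψ using hH
  have hgZ : ∀ q, g q ∈ Submodule.span (MvPolynomial σ K) (Set.range ψ) :=
    fun q => hspan ▸ hs ▸ Submodule.subset_span ⟨q, rfl⟩
  have hcomp : ∀ G : κ → Fin r → MvPolynomial σ K,
      (∀ q, Fintype.linearCombination (MvPolynomial σ K) ψ (G q) = g q) → ∀ c,
      Fintype.linearCombination (MvPolynomial σ K) ψ
        (Fintype.linearCombination (MvPolynomial σ K) G c) =
        Fintype.linearCombination (MvPolynomial σ K) g c := by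
    intro G hG c
    rw [Fintype.linearCombination_apply (MvPolynomial σ K) G, map_sum,
      Fintype.linearCombination_apply (MvPolynomial σ K) g]
    simp only [map_smul, hG]
  have hsub : ∀ G : κ → Fin r → MvPolynomial σ K,
      (∀ q, Fintype.linearCombination (MvPolynomial σ K) ψ (G q) = g q) → ∀ p,
      Pi.single p 1 - Fintype.linearCombination (MvPolynomial σ K) G (H p) ∈
        LinearMap.ker (Fintype.linearCombination (MvPolynomial σ K) ψ) := by
    intro G hG p
    rw [LinearMap.mem_ker, map_sub, hcomp G hG, hHψ, Fintype.linearCombination_apply_single,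
      one_smul, sub_self]
  -- If `j p` were positive, the product of the transition matrices would have constant term `0`
  -- instead of `1` at the diagonal position `p`.
  have hj0 : ∀ p, j p = 0 := by
    intro p
    by_contra hne
    have hG : ∀ q, ∃ c, Fintype.linearCombination (MvPolynomial σ K) ψ c = g q := fun q => by
      have := hgZ q
      rwa [← Fintype.range_linearCombination] at this
    choose G hG using hG
    have := hmin _ (hsub G hG p) p
    rw [Pi.sub_apply, map_sub, Fintype.linearCombination_apply, Finset.sum_apply, map_sum,
      Finset.sum_eq_zero, Pi.single_eq_same, map_one, sub_zero] at this
    · exact one_ne_zero this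
    · intro q _
      rw [Pi.smul_apply, smul_eq_mul, map_mul, (hHj p).constantCoeff_eq_zero hne, zero_mul]
  have hdeg : ∀ p, deg p = e := fun p => by rw [hj, hj0, add_zero]
  refine ⟨hdeg, ?_⟩
  have hψe : ∀ p, HomVec e (ψ p) := fun p => hdeg p ▸ hψ p
  -- Now that all degrees agree, the transition matrix `G` can be chosen with constant entries.
  have hG : ∀ q, ∃ c, HomVec 0 c ∧ Fintype.linearCombination (MvPolynomial σ K) ψ c = g q :=
    fun q => exists_homVec_linearCombination hψe (hgZ q) (hg q)
  choose G hG0 hG using hG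
  have hH0 : ∀ p, HomVec 0 (H p) := fun p => hj0 p ▸ hHj p
  have hone : ∀ {ι : Type} [DecidableEq ι] (q : ι),
      HomVec 0 (Pi.single q 1 : ι → MvPolynomial σ K) := by
    intro ι _ q p
    by_cases h : p = q
    · subst h
      rw [Pi.single_eq_same]
      exact isHomogeneous_one σ K
    · rw [Pi.single_eq_of_ne h]
      exact isHomogeneous_zero _ _ _
  have hGH : ∀ p, Fintype.linearCombination (MvPolynomial σ K) G (H p) = Pi.single p 1 := by
    intro p
    refine (sub_eq_zero.1 (HomVec.eq_zero_of_constantCoeff (fun q => ?_)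
      (hmin _ (hsub G hG p)))).symm
    exact (hone p q).sub ((HomVec.linearCombination hG0 (hH0 p)) q)
  have hcompH : ∀ c, Fintype.linearCombination (MvPolynomial σ K) g
      (Fintype.linearCombination (MvPolynomial σ K) H c) =
      Fintype.linearCombination (MvPolynomial σ K) ψ c := by
    intro c
    rw [Fintype.linearCombination_apply (MvPolynomial σ K) H, map_sum,
      Fintype.linearCombination_apply (MvPolynomial σ K) ψ]
    simp only [map_smul, hHψ]
  classical
  have hHG : ∀ q, Fintype.linearCombination (MvPolynomial σ K) H (G q) = Pi.single q 1 := by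
    intro q
    have hmem : Pi.single q 1 - Fintype.linearCombination (MvPolynomial σ K) H (G q) ∈
        LinearMap.ker (Fintype.linearCombination (MvPolynomial σ K) g) := by
      rw [LinearMap.mem_ker, map_sub, hcompH, hG, Fintype.linearCombination_apply_single,
        one_smul, sub_self]
    refine (sub_eq_zero.1 (HomVec.eq_zero_of_constantCoeff (fun p => ?_)
      (hl.constantCoeff_eq_zero hmem))).symm
    exact (hone q p).sub ((HomVec.linearCombination hH0 (hG0 q)) p)
  have hGH' : ∀ c, Fintype.linearCombination (MvPolynomial σ K) G
      (Fintype.linearCombination (MvPolynomial σ K) H c) = c := by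
    intro c
    rw [Fintype.linearCombination_apply (MvPolynomial σ K) H, map_sum]
    simp only [map_smul, hGH]
    funext p
    simp [Finset.sum_apply, Pi.single_apply]
  have hHG' : ∀ c, Fintype.linearCombination (MvPolynomial σ K) H
      (Fintype.linearCombination (MvPolynomial σ K) G c) = c := by
    intro c
    rw [Fintype.linearCombination_apply (MvPolynomial σ K) G, map_sum]
    simp only [map_smul, hHG]
    funext p
    simp [Finset.sum_apply, Pi.single_apply]
  convert hl.map (Fintype.linearCombination (MvPolynomial σ K) G)
    (Function.LeftInverse.injective hHG') (fun v hv => ?_) using 1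
  · ext c
    rw [LinearMap.mem_ker, Submodule.mem_map]
    constructor
    · intro h
      exact ⟨_, by rw [LinearMap.mem_ker, hcompH, h], hGH' c⟩
    · rintro ⟨c, hc, rfl⟩
      rw [hcomp G hG]
      exact hc
  · have := HomVec.linearCombination hG0 hv
    rwa [zero_add] at this

lemma linearCombination_single_one {M : Type*} [AddCommGroup M] [Module (MvPolynomial σ K) M]
    {r : ℕ} (f : (Fin r → MvPolynomial σ K) →ₗ[MvPolynomial σ K] M) :
    Fintype.linearCombination (MvPolynomial σ K) (fun q => f (Pi.single q 1)) = f := by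
  refine LinearMap.pi_ext' fun q => LinearMap.ext_ring ?_
  simp [Fintype.linearCombination_apply_single]

lemma constantCoeff_eq_zero_of_isMinimal {I : Ideal (MvPolynomial σ K)}
    {F : GradedFreeResolution I} (hF : F.IsMinimal) (i : ℕ) {c : Fin (F.rank i) → MvPolynomial σ K}
    (hc : c ∈ LinearMap.range (F.d i)) (p : Fin (F.rank i)) : constantCoeff (c p) = 0 := by
  rw [← linearCombination_single_one (F.d i)] at hc
  obtain ⟨b, rfl⟩ := hc
  rw [Fintype.linearCombination_apply, Finset.sum_apply, map_sum]
  refine Finset.sum_eq_zero fun q _ => ?_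
  rw [Pi.smul_apply, smul_eq_mul, map_mul, hF, mul_zero]

/-- Every minimal graded free resolution of a linearly resolved ideal is linear. -/
theorem LinearlyResolved.isLinear {N d : ℕ} {I : Ideal (MvPolynomial σ K)}
    (h : LinearlyResolved N d (idealModule I)) {F : GradedFreeResolution I} (hF : F.IsMinimal) :
    F.IsLinear d := by
  have key : ∀ i, (∀ p, F.deg i p = d + i) ∧
      LinearlyResolved N 1 (LinearMap.range (F.d i)) := by
    intro i
    induction i with
    | zero =>
      have happ : ∀ c, Fintype.linearCombination (MvPolynomial σ K)
          (fun q (_ : Unit) => F.aug (Pi.single q 1)) c = fun _ => F.aug c := by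
        intro c
        conv_rhs => rw [← linearCombination_single_one F.aug]
        funext x
        simp [Fintype.linearCombination_apply, Finset.sum_apply]
      have hker : LinearMap.ker (Fintype.linearCombination (MvPolynomial σ K)
          (fun q (_ : Unit) => F.aug (Pi.single q 1))) = LinearMap.range (F.d 0) := by
        rw [F.exact_zero]
        ext c
        rw [LinearMap.mem_ker, LinearMap.mem_ker, happ]
        exact ⟨fun h => congrFun h (), fun h => funext fun _ => h⟩
      have := h.of_minimal (ψ := fun q (_ : Unit) => F.aug (Pi.single q 1)) (deg := F.deg 0)
        (fun p _ => F.aug_homogeneous p) (by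
          rw [← Fintype.range_linearCombination]
          ext v
          rw [mem_idealModule]
          have hv : v () ∈ I ↔ v () ∈ LinearMap.range F.aug := by rw [F.range_aug]
          rw [hv]
          constructor
          · rintro ⟨c, hc⟩
            exact ⟨c, by rw [← hc, happ]⟩
          · rintro ⟨c, hc⟩
            exact ⟨c, by rw [happ, hc]⟩) (by
          rw [hker]
          exact fun c hc p => constantCoeff_eq_zero_of_isMinimal hF 0 hc p)
      rw [hker] at this
      exact this
    | succ i ih =>
      obtain ⟨hdeg, hlin⟩ := ih
      have hker : LinearMap.ker (Fintype.linearCombination (MvPolynomial σ K)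
          (fun q => F.d i (Pi.single q 1))) = LinearMap.range (F.d (i + 1)) := by
        rw [linearCombination_single_one, F.exact_succ]
      have hmin : ∀ c ∈ LinearMap.ker (Fintype.linearCombination (MvPolynomial σ K)
          (fun q => F.d i (Pi.single q 1))), ∀ p, constantCoeff (c p) = 0 := by
        rw [hker]
        exact fun c hc p => constantCoeff_eq_zero_of_isMinimal hF (i + 1) hc p
      -- A column of degree smaller than `d + i` would vanish, which minimality excludes.
      have hle : ∀ q, d + i ≤ F.deg (i + 1) q := by
        intro q
        by_contra hlt
        have h0 : F.d i (Pi.single q 1) = 0 := by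
          funext p
          by_contra hne
          obtain ⟨e, he⟩ := support_nonempty.2 hne
          have := F.d_homogeneous i q p e he
          rw [hdeg] at this
          omega
        have := hmin (Pi.single q 1) (by
          rw [LinearMap.mem_ker, Fintype.linearCombination_apply_single, h0, smul_zero]) q
        simp at this
      have := hlin.of_minimal (ψ := fun q => F.d i (Pi.single q 1))
        (deg := fun q => F.deg (i + 1) q - (d + i)) (fun q p e he => by
          have := F.d_homogeneous i q p e (mem_support_iff.2 he)
          rw [hdeg] at this
          have hw : Finsupp.weight 1 e = e.degree := by rw [Finsupp.degree_eq_weight_one]; rfl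
          rw [hw]
          omega) (by
          rw [← Fintype.range_linearCombination, linearCombination_single_one]) hmin
      rw [hker] at this
      refine ⟨fun p => ?_, this.2⟩
      have h1 := this.1 p
      have h2 := hle p
      omega
  exact fun i p => (key i).1 p

/-- A nonzero linearly resolved ideal generated in degree `d` has regularity `d`. -/
theorem LinearlyResolved.hasRegularity {N d : ℕ} {I : Ideal (MvPolynomial σ K)}
    (h : LinearlyResolved N d (idealModule I)) (hI : I ≠ ⊥) : HasRegularity I d := by
  obtain ⟨F, hF, -⟩ := h.hasLinearResolution
  refine ⟨⟨F, hF⟩, fun F hF => ?_⟩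
  have hlin := h.isLinear hF
  constructor
  · have hpos : 0 < F.rank 0 := by
      by_contra h0
      have : IsEmpty (Fin (F.rank 0)) := ⟨fun p => h0 p.pos⟩
      apply hI
      rw [← F.range_aug, LinearMap.range_eq_bot]
      exact LinearMap.ext fun c => by rw [Subsingleton.elim c 0, map_zero, map_zero]
    exact ⟨0, ⟨0, hpos⟩, by simp [hlin 0]⟩
  · rintro _ ⟨i, p, rfl⟩
    rw [hlin i p]
    simp

/-! ### Products of ideals of diagonal monomials -/

/-- The `i`-th smallest values of two families `f` and `g` are separated by the values of `f` and `g`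
at one common index. Hence `f ≤ g` and `f < g` are inherited by the sorted families. -/
lemma exists_le_of_monotone_comp {α : Type*} [Preorder α] {s : ℕ} {f g : Fin s → α}
    {τ ρ : Equiv.Perm (Fin s)} (hf : Monotone (f ∘ τ)) (hg : Monotone (g ∘ ρ)) (i : Fin s) :
    ∃ t, f (τ i) ≤ f t ∧ g t ≤ g (ρ i) := by
  obtain ⟨j, hj, hij⟩ : ∃ j ≤ i, i ≤ τ.symm (ρ j) := by
    by_contra! h
    have := Finset.card_le_card_of_injOn (s := Finset.Iic i) (t := Finset.Iio i)
      (fun j => τ.symm (ρ j)) (fun j hj => by simpa using h j (by simpa using hj))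
      (fun x _ y _ hxy => ρ.injective (τ.symm.injective hxy))
    rw [Fin.card_Iic, Fin.card_Iio] at this
    omega
  exact ⟨ρ j, by simpa using hf hij, hg hj⟩

variable {m n s : ℕ}

/-- The exponent vector of the monomial `∏ X_{a, b (a, i)}`, where `b` is an array with rows indexed
by `a` and columns indexed by `i`. -/
noncomputable def arrayExponent (b : Fin m × Fin s → Fin n) : Fin m × Fin n →₀ ℕ :=
  ∑ p, Finsupp.single (p.1, b p) 1

lemma arrayExponent_apply (b : Fin m × Fin s → Fin n) (a : Fin m) (v : Fin n) :
    arrayExponent b (a, v) = (Finset.univ.filter fun p => p.1 = a ∧ b p = v).card := by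
  simp [arrayExponent, Finsupp.finsetSum_apply, Finsupp.single_apply]

lemma degree_arrayExponent (b : Fin m × Fin s → Fin n) : (arrayExponent b).degree = s * m := by
  simp [arrayExponent, mul_comm]

lemma monomial_arrayExponent (b : Fin m × Fin s → Fin n) :
    (monomial (arrayExponent b) 1 : MvPolynomial (Fin m × Fin n) K) = ∏ p, X (p.1, b p) := by
  rw [arrayExponent, monomial_sum_one]
  rfl

lemma arrayExponent_update_le (b : Fin m × Fin s → Fin n) (p : Fin m × Fin s) (v : Fin n) :
    arrayExponent (Function.update b p v) ≤ arrayExponent b + Finsupp.single (p.1, v) 1 := by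
  rw [arrayExponent, arrayExponent, ← Finset.add_sum_erase _ _ (Finset.mem_univ p),
    ← Finset.add_sum_erase (a := p) _ (fun q => Finsupp.single (q.1, b q) 1) (Finset.mem_univ p),
    Function.update_self, add_comm (Finsupp.single _ _ : Fin m × Fin n →₀ ℕ)]
  refine add_le_add ?_ le_rfl
  have : ∑ q ∈ Finset.univ.erase p, Finsupp.single (q.1, Function.update b p v q) 1 =
      ∑ q ∈ Finset.univ.erase p, (Finsupp.single (q.1, b q) 1 : Fin m × Fin n →₀ ℕ) :=
    Finset.sum_congr rfl fun q hq => by rw [Function.update_of_ne (Finset.ne_of_mem_erase hq)]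
  rw [this]
  exact le_add_self

/-- The sorted arrays: the columns are strictly increasing sequences, the `i`-th one with values
between `k i` and `l i`, and the rows are weakly increasing. -/
structure IsSortedArray (k l : Fin s → Fin n) (b : Fin m × Fin s → Fin n) : Prop where
  row : ∀ a i j, i ≤ j → b (a, i) ≤ b (a, j)
  col : ∀ a a' i, a < a' → b (a, i) < b (a', i)
  lower : ∀ a i, k i ≤ b (a, i)
  upper : ∀ a i, b (a, i) ≤ l i

/-- If `b'` agrees with the sorted array `b` in all rows above `a` and in row `a` to the left of
column `i`, and has a smaller entry at `(a, i)`, then this entry can be moved to `b`. -/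
lemma IsSortedArray.update {k l : Fin s → Fin n} {b b' : Fin m × Fin s → Fin n}
    (hb : IsSortedArray k l b) (hb' : IsSortedArray k l b') {a : Fin m} {i : Fin s}
    (hrow : ∀ a' < a, ∀ j, b' (a', j) = b (a', j)) (hleft : ∀ j < i, b' (a, j) = b (a, j))
    (hlt : b' (a, i) < b (a, i)) :
    IsSortedArray k l (Function.update b (a, i) (b' (a, i))) := by
  have hne : ∀ {a' j}, (a', j) ≠ (a, i) →
      Function.update b (a, i) (b' (a, i)) (a', j) = b (a', j) :=
    fun h => Function.update_of_ne h _ _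
  have hle : ∀ a' j, Function.update b (a, i) (b' (a, i)) (a', j) ≤ b (a', j) := by
    intro a' j
    by_cases h : (a', j) = (a, i)
    · rw [h, Function.update_self]
      exact hlt.le
    · rw [hne h]
  refine ⟨fun a' j j' hj => ?_, fun a' a'' j h => ?_, fun a' j => ?_, fun a' j =>
    (hle a' j).trans (hb.upper a' j)⟩
  · by_cases h : (a', j') = (a, i)
    · obtain ⟨rfl, rfl⟩ := Prod.mk.inj h
      rcases hj.eq_or_lt with rfl | hj
      · exact le_rfl
      · rw [Function.update_self, hne (by simp [hj.ne]), ← hleft j hj]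
        exact hb'.row _ _ _ hj.le
    · rw [hne h]
      exact (hle a' j).trans (hb.row _ _ _ hj)
  · by_cases h' : (a'', j) = (a, i)
    · obtain ⟨rfl, rfl⟩ := Prod.mk.inj h'
      rw [Function.update_self, hne (by simp [h.ne]), ← hrow a' h]
      exact hb'.col _ _ _ h
    · rw [hne h']
      exact (hle a' j).trans_lt (hb.col _ _ _ h)
  · by_cases h : (a', j) = (a, i)
    · obtain ⟨rfl, rfl⟩ := Prod.mk.inj h
      rw [Function.update_self]
      exact hb'.lower _ _
    · rw [hne h]
      exact hb.lower _ _

lemma IsSortedArray.arrayExponent_lt {k l : Fin s → Fin n} {b b' : Fin m × Fin s → Fin n}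
    (hb : IsSortedArray k l b) {a : Fin m} {i : Fin s}
    (hleft : ∀ j < i, b' (a, j) = b (a, j)) (hlt : b' (a, i) < b (a, i)) :
    arrayExponent b (a, b' (a, i)) < arrayExponent b' (a, b' (a, i)) := by
  rw [arrayExponent_apply, arrayExponent_apply]
  refine Finset.card_lt_card ((Finset.ssubset_iff_of_subset ?_).2 ⟨(a, i), by simp, by
    simp [hlt.ne']⟩)
  rintro ⟨a', j⟩ hp
  obtain ⟨rfl, hv⟩ := (Finset.mem_filter.1 hp).2
  have hj : j < i := by
    by_contra h
    exact absurd (hb.row a' i j (not_lt.1 h)) (not_le.2 (hv ▸ hlt))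
  exact Finset.mem_filter.2 ⟨Finset.mem_univ _, rfl, by rw [hleft j hj, hv]⟩

/-- The product of the ideals `J_{k_i l_i}` is generated by the monomials of the sorted arrays: a
product of diagonal monomials does not change when the rows of the array formed by its factors are
sorted, and sorting the rows respects the bounds, since `k` and `l` are monotone, and the strict
inequalities in the columns. -/
lemma prod_diagonalIdeal {k l : Fin s → Fin n} (hk : Monotone k) (hl : Monotone l) :
    ∏ i, diagonalIdeal K m (k i) (l i) =
      Ideal.span ((fun b => monomial (arrayExponent b) 1) ''
        {b : Fin m × Fin s → Fin n | IsSortedArray k l b}) := by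
  unfold diagonalIdeal
  rw [Ideal.prod_span]
  congr 1
  ext x
  rw [Set.mem_fintype_prod]
  constructor
  · rintro ⟨g, hg, rfl⟩
    choose c hc hckl hgc using hg
    let τ : Fin m → Equiv.Perm (Fin s) := fun a => Tuple.sort fun i => c i a
    have hτ : ∀ a, Monotone ((fun i => c i a) ∘ τ a) := fun a => Tuple.monotone_sort _
    refine ⟨fun p => c (τ p.1 p.2) p.1, ⟨fun a i j hij => hτ a hij, fun a a' i h => ?_,
      fun a i => ?_, fun a i => ?_⟩, ?_⟩
    · obtain ⟨t, h1, h2⟩ := exists_le_of_monotone_comp (hτ a) (hτ a') i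
      exact h1.trans_lt ((hc t h).trans_le h2)
    · obtain ⟨t, h1, h2⟩ := exists_le_of_monotone_comp (τ := Equiv.refl _) hk (hτ a) i
      exact h1.trans ((hckl t a).1.trans h2)
    · obtain ⟨t, h1, h2⟩ := exists_le_of_monotone_comp (ρ := Equiv.refl _) (hτ a) hl i
      exact h1.trans ((hckl t a).2.trans h2)
    · change monomial (arrayExponent _) 1 = _
      rw [monomial_arrayExponent, Fintype.prod_prod_type]
      simp only [hgc, diagonalMonomial, Matrix.mvPolynomialX_apply]
      refine Eq.trans ?_ Finset.prod_comm
      exact Finset.prod_congr rfl fun a _ =>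
        Equiv.prod_comp (τ a) fun i => (X (a, c i a) : MvPolynomial (Fin m × Fin n) K)
  · rintro ⟨b, hb : IsSortedArray k l b, rfl⟩
    refine ⟨fun i => diagonalMonomial K fun a => b (a, i), fun i => ⟨_, fun a a' h => hb.col _ _ _ h,
      fun a => ⟨hb.lower a i, hb.upper a i⟩, rfl⟩, ?_⟩
    change _ = monomial (arrayExponent b) 1
    rw [monomial_arrayExponent, Fintype.prod_prod_type, Finset.prod_comm]
    rfl

lemma diagonalIdeal_ne_bot {k l : Fin n} (h : m + (k : ℕ) ≤ (l : ℕ) + 1) :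
    diagonalIdeal K m k l ≠ ⊥ := by
  intro hbot
  let c : Fin m → Fin n := fun a => ⟨k + a, by omega⟩
  have hmem : diagonalMonomial K c ∈ diagonalIdeal K m k l :=
    Ideal.subset_span ⟨c, fun a a' h => Fin.mk_lt_mk.2 (by omega), fun a =>
      ⟨Fin.mk_le_mk.2 (by omega), Fin.mk_le_mk.2 (by omega)⟩, rfl⟩
  rw [hbot, Ideal.mem_bot, diagonalMonomial, Finset.prod_eq_zero_iff] at hmem
  obtain ⟨a, -, ha⟩ := hmem
  exact X_ne_zero _ ha

/-- The generators of the product have linear quotients when the sorted arrays are ordered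
lexicographically, reading the entries row by row. -/
theorem exists_linearlyResolved_prod_diagonalIdeal {k l : Fin s → Fin n} (hk : Monotone k)
    (hl : Monotone l) :
    ∃ N, LinearlyResolved N (s * m) (idealModule (∏ i, diagonalIdeal K m (k i) (l i))) := by
  classical
  let arr : Lex ((Fin m ×ₗ Fin s) → Fin n) → Fin m × Fin s → Fin n :=
    fun b p => ofLex b (toLex p)
  let B : Finset (Lex ((Fin m ×ₗ Fin s) → Fin n)) :=
    Finset.univ.filter fun b => IsSortedArray k l (arr b)
  have hB : ∀ b, b ∈ B ↔ IsSortedArray k l (arr b) := by simp [B]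
  obtain ⟨N, hN⟩ := exists_linearlyResolved_of_linearQuotients (K := K)
    (fun b => arrayExponent (arr b)) (s * m) B (fun b _ => degree_arrayExponent _) (by
      rintro b hb b' hb' ⟨p, hp, hlt⟩
      obtain ⟨⟨a, i⟩, rfl⟩ := toLex.surjective p
      rw [hB] at hb hb'
      have hrow : ∀ a' < a, ∀ j, arr b' (a', j) = arr b (a', j) := fun a' h j =>
        hp _ (Prod.Lex.toLex_lt_toLex.2 (Or.inl h))
      have hleft : ∀ j < i, arr b' (a, j) = arr b (a, j) := fun j h =>
        hp _ (Prod.Lex.toLex_lt_toLex.2 (Or.inr ⟨rfl, h⟩))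
      refine ⟨(a, arr b' (a, i)), hb.arrayExponent_lt hleft hlt,
        toLex fun q => Function.update (arr b) (a, i) (arr b' (a, i)) (ofLex q), ?_, ?_, ?_⟩
      · rw [hB]
        exact hb.update hb' hrow hleft hlt
      · refine ⟨toLex (a, i), fun q hq => ?_, ?_⟩
        · have : ofLex q ≠ (a, i) := fun h => hq.ne (by rw [← h, toLex_ofLex])
          exact Function.update_of_ne this _ _
        · change Function.update (arr b) (a, i) (arr b' (a, i)) (a, i) < _
          rw [Function.update_self]
          exact hlt
      · exact arrayExponent_update_le _ _ _)
  refine ⟨N, ?_⟩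
  convert hN using 2
  rw [prod_diagonalIdeal hk hl]
  congr 1
  ext x
  constructor
  · rintro ⟨b, hb, rfl⟩
    exact ⟨toLex fun q => b (ofLex q), Finset.mem_coe.2 ((hB _).2 hb), rfl⟩
  · rintro ⟨b, hb, rfl⟩
    exact ⟨arr b, (hB b).1 (Finset.mem_coe.1 hb), rfl⟩

end LinearResolution

theorem mainTheorem1 {K : Type*} [Field K] {m n s : ℕ} (k l : Fin s → Fin n)
    (hk : Monotone k) (hl : Monotone l) (hkl : ∀ i, k i < l i)
    (hm : ∀ i, m + (k i : ℕ) ≤ (l i : ℕ) + 1) :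
    HasLinearResolution (∏ i, diagonalIdeal K m (k i) (l i)) (s * m) ∧
      HasRegularity (∏ i, diagonalIdeal K m (k i) (l i)) ((s : ℤ) * (m : ℤ)) := by
  obtain ⟨N, hN⟩ := LinearResolution.exists_linearlyResolved_prod_diagonalIdeal (K := K) (m := m)
    hk hl
  refine ⟨hN.hasLinearResolution, ?_⟩
  rw [← Nat.cast_mul]
  exact hN.hasRegularity (Finset.prod_ne_zero_iff.2 fun i _ =>
    LinearResolution.diagonalIdeal_ne_bot (hm i))
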